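/- **Setting.** Let $p\ge 0$, $k\ge 1$, $c\in\mathbb R^p$ and $f_0,\dots,f_k:\mathbb R^p\to\mathbb R^p$, and consider the nonlinear VAR($k$) model $$f_0(z_t)=c+\sum_{i=1}^k f_i(z_{t-i})+u_t .$$ Put $g_j(z)=-\sum_{i=j+1}^k f_i(z)$ for $0\le j\le k-1$ and $\pi(z)=-f_0(z)+\sum_{i=1}^k f_i(z)$. Let $D\in\mathbb R^{p(k-1)\times p(k-1)}$ be the block matrix with $-I_p$ in the diagonal blocks, $I_p$ in the blocks just above the diagonal and zero elsewhere; let $E\in\mathbb R^{p(k-1)\times p}$ have $I_p$ as its first block and zeros below ($D$ and $E$ are empty if $k=1$). For $\alpha\in\mathbb R^{p\times r}$ and $\theta:\mathbb R^p\to\mathbb R^r$ put $$\boldsymbol\theta(z)=\begin{bmatrix}\theta(z)\\ g_1(z)\\ \vdots\\ g_{k-1}(z)\end{bmatrix},\qquad \boldsymbol D_0=\begin{bmatrix}0_{r\times p}&0\\0&D\end{bmatrix},\qquad \boldsymbol\alpha=\begin{bmatrix}\alpha&E^{\top}\\0&I_{p(k-1)}\end{bmatrix}.$$ Vector norms are Euclidean,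 and matrix norms are the induced ones. For a bounded set $\mathcal A$ of square matrices, $\rho_{\mathrm{JSR}}(\mathcal A)=\limsup_{t\to\infty}\sup_{B\in\mathcal A^t}\rho(B)^{1/t}$, where $\mathcal A^t$ is the set of $t$-fold products of elements of $\mathcal A$ and $\rho(B)$ is the spectral radius. **Assumption CVAR.** For some $r\in\{0,\dots,p\}$, $\alpha\in\mathbb R^{p\times r}$ of rank $r$, $\bar b\in\mathbb R$ and $\bar\rho\in[0,1)$: 1. $f_0$ is a homeomorphism of $\mathbb R^p$; 2. there are $\mu\in\mathbb R^r$ and $\theta:\mathbb R^p\to\mathbb R^r$ with $c=\alpha\mu$ and $\pi(z)=\alpha\theta(z)$ for all $z$; 3. there is a closed set $\mathcal B\subset\mathbb R^{kp\times[p(k-1)+r]}$ with $\|\boldsymbol\beta\|\le\bar b$ for all $\boldsymbol\beta\in\mathcal B$ and $\rho_{\mathrm{JSR}}(\{I+\boldsymbol\beta^{\top}\boldsymbol\alpha:\boldsymbol\beta\in\mathcal B\})\le\bar\rho$, such that for all $\boldsymbol z=(z,\zeta)$ and $\boldsymbol z'=(z',\zeta')$ in $\mathbb R^p\times\mathbb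 R^{p(k-1)}$ some $\boldsymbol\beta\in\mathcal B$ satisfies $$[\boldsymbol\theta(f_0^{-1}(z))+\boldsymbol D_0\boldsymbol z]-[\boldsymbol\theta(f_0^{-1}(z'))+\boldsymbol D_0\boldsymbol z']=\boldsymbol\beta^{\top}(\boldsymbol z-\boldsymbol z').$$ Let $q=p-r$, and let $\alpha_\perp\in\mathbb R^{p\times q}$ be any matrix of rank $q$ with $\alpha_\perp^{\top}\alpha=0$. For $z\in\mathbb R^p$ and a state $\varsigma=(\varsigma_{(1)},\dots,\varsigma_{(k)})\in\mathbb R^{kp}$ define $$h(z)=f_0(z)-\sum_{i=1}^{k-1}g_i(z),\qquad \bar h(\varsigma)=f_0(\varsigma_{(1)})-\sum_{i=1}^{k-1}g_i(\varsigma_{(i+1)}),\qquad \chi(z)=\begin{bmatrix}\alpha_\perp^{\top}h(z)\\ \theta(z)\end{bmatrix}\in\mathbb R^q\times\mathbb R^r,$$ and $\mathcal M_\mu=\{z\in\mathbb R^p:\theta(z)=-\mu\}$. For $u\in\mathbb R^p$ let $z_t(u;\varsigma)$, $t\ge\tau$, be the solution of the model with $(z_{\tau-1},\dots,z_{\tau-k})=\varsigma$,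 $u_\tau=u$ and $u_t=0$ for all $t>\tau$. For $z\in\mathbb R^p$, the *domain of attraction* of $z$ given $\varsigma$ is $\mathcal U(z;\varsigma)=\{u\in\mathbb R^p: z_t(u;\varsigma)\to z \text{ as } t\to\infty\}$. A set $S\subset\mathbb R^p$ is *strictly stable* if for all $(u,\varsigma)$ the path $z_t(u;\varsigma)$ converges to some point of $S$, and for every $z\in S$ and every state $\varsigma$ the set $\mathcal U(z;\varsigma)$ is non-empty. **Theorem (strict stability of the attractor space).** Suppose Assumption CVAR holds. Then $\chi$ is a homeomorphism of $\mathbb R^p$ onto $\mathbb R^q\times\mathbb R^r$, and $\mathcal M_\mu=\{z:\pi(z)=-c\}$ is a $q$-dimensional topological manifold (homeomorphic to $\mathbb R^q$). Moreover: (i) for every $(u,\varsigma)\in\mathbb R^p\times\mathbb R^{kp}$, as $t\to\infty$, $$z_t(u;\varsigma)\to z_\infty(u;\varsigma)=\chi^{-1}\begin{bmatrix}\alpha_\perp^{\top}[\bar h(\varsigma)+u]\\-\mu\end{bmatrix}\in\mathcal M_\mu;$$ (ii) for every $(z,\varsigma)\in\mathcal M_\mu\times\mathbb R^{kp}$, the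 domain of attraction of $z$ given $\varsigma$ is the $r$-dimensional affine subspace $$\mathcal U(z;\varsigma)=\operatorname{span}(\alpha)+[h(z)-\bar h(\varsigma)];$$ and hence $\mathcal M_\mu$ is strictly stable. -/

import Mathlib

open Filter Topology

/-- Parameters `(c, f₀, …, f_k)` of the `p`-dimensional nonlinear VAR(`k`) model
`f₀(z_t) = c + ∑_{i=1}^k f_i(z_{t-i}) + u_t`, with lag order `k = m + 1 ≥ 1`. -/
structure NLVAR (p m : ℕ) where
  c : Fin p → ℝ
  f : Fin (m + 2) → (Fin p → ℝ) → (Fin p → ℝ)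

/-- `ρ(B)`: the largest modulus of a complex eigenvalue of the real matrix `B`. -/
noncomputable def realSpectralRadius {n : Type*} [Fintype n] [DecidableEq n]
    (B : Matrix n n ℝ) : ENNReal :=
  spectralRadius ℂ (B.map (algebraMap ℝ ℂ))

/-- `𝒜^t`: the set of `t`-fold products of matrices in `𝒜`. -/
def matrixProducts {n : Type*} [Fintype n] [DecidableEq n]
    (𝒜 : Set (Matrix n n ℝ)) (t : ℕ) : Set (Matrix n n ℝ) :=
  {B | ∃ M : Fin t → Matrix n n ℝ, (∀ s, M s ∈ 𝒜) ∧ B = (List.ofFn M).prod}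

/-- The joint spectral radius `limsup_{t → ∞} sup_{B ∈ 𝒜^t} ρ(B)^{1/t}`. -/
noncomputable def jointSpectralRadius {n : Type*} [Fintype n] [DecidableEq n]
    (𝒜 : Set (Matrix n n ℝ)) : ENNReal :=
  limsup (fun t : ℕ => ⨆ B ∈ matrixProducts 𝒜 t, realSpectralRadius B ^ (1 / (t : ℝ))) atTop

/-- The matrix norm induced by the Euclidean vector norms. -/
noncomputable def euclideanOpNorm {n l : Type*} [Fintype n] [Fintype l] [DecidableEq l]
    (A : Matrix n l ℝ) : ℝ :=
  ‖LinearMap.toContinuousLinearMap (Matrix.toEuclideanLin A)‖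

namespace NLVAR

variable {p m : ℕ}

/-- `g_j(z) = -∑_{i=j+1}^k f_i(z)`, for `0 ≤ j ≤ k - 1`. -/
noncomputable def g (M : NLVAR p m) (j : ℕ) (z : Fin p → ℝ) : Fin p → ℝ :=
  -∑ i ∈ Finset.univ.filter (fun i : Fin (m + 1) => j ≤ (i : ℕ)), M.f i.succ z

/-- `π(z) = -f₀(z) + ∑_{i=1}^k f_i(z)`. -/
noncomputable def eqmap (M : NLVAR p m) (z : Fin p → ℝ) : Fin p → ℝ :=
  -M.f 0 z + ∑ i : Fin (m + 1), M.f i.succ z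

/-- The `p(k-1) × p(k-1)` matrix `D`, with `-I_p` in the diagonal blocks and `I_p` in the blocks
just above the diagonal. -/
def blockD (p m : ℕ) : Matrix (Fin m × Fin p) (Fin m × Fin p) ℝ :=
  Matrix.of fun x y =>
    if x.2 = y.2 then
      if x.1 = y.1 then -1 else if (y.1 : ℕ) = x.1 + 1 then 1 else 0
    else 0

/-- The `p(k-1) × p` matrix `E`, whose first block is `I_p` and whose other blocks vanish. -/
def blockE (p m : ℕ) : Matrix (Fin m × Fin p) (Fin p) ℝ :=
  Matrix.of fun x b => if (x.1 : ℕ) = 0 ∧ x.2 = b then 1 else 0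

/-- The matrix `[0 0; 0 D]`, of size `[r + p(k-1)] × [p + p(k-1)]`. -/
def boldD₀ (p m r : ℕ) : Matrix (Fin r ⊕ Fin m × Fin p) (Fin p ⊕ Fin m × Fin p) ℝ :=
  Matrix.fromBlocks 0 0 0 (blockD p m)

/-- The matrix `[α Eᵀ; 0 I]`, of size `[p + p(k-1)] × [r + p(k-1)]`. -/
def boldα (m : ℕ) {r : ℕ} (α : Matrix (Fin p) (Fin r) ℝ) :
    Matrix (Fin p ⊕ Fin m × Fin p) (Fin r ⊕ Fin m × Fin p) ℝ :=
  Matrix.fromBlocks α (blockE p m).transpose 0 1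

/-- The stacked map `z ↦ (θ(z), g_1(z), …, g_{k-1}(z))`. -/
noncomputable def boldθ (M : NLVAR p m) {r : ℕ} (θ : (Fin p → ℝ) → (Fin r → ℝ))
    (z : Fin p → ℝ) : Fin r ⊕ Fin m × Fin p → ℝ :=
  Sum.elim (θ z) fun x => M.g (x.1 + 1) z x.2

/-- The map `(z, ζ) ↦ (𝛉 ∘ f₀⁻¹)(z) + D₀ (z, ζ)` on `ℝ^p × ℝ^{p(k-1)}`. -/
noncomputable def boldMap (M : NLVAR p m) {r : ℕ} (θ : (Fin p → ℝ) → (Fin r → ℝ))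
    (x : Fin p ⊕ Fin m × Fin p → ℝ) : Fin r ⊕ Fin m × Fin p → ℝ :=
  M.boldθ θ (Function.invFun (M.f 0) fun a => x (Sum.inl a)) + (boldD₀ p m r).mulVec x

/-- Membership of the class `CVAR_r(α, b, ρ)`. -/
def InCVAR (M : NLVAR p m) {r : ℕ} (α : Matrix (Fin p) (Fin r) ℝ) (b ρ : ℝ) : Prop :=
  α.rank = r ∧ 0 ≤ ρ ∧ ρ < 1 ∧
  IsHomeomorph (M.f 0) ∧
  ∃ (μ : Fin r → ℝ) (θ : (Fin p → ℝ) → (Fin r → ℝ)),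
    M.c = α.mulVec μ ∧ (∀ z, M.eqmap z = α.mulVec (θ z)) ∧
    ∃ ℬ : Set (Matrix (Fin p ⊕ Fin m × Fin p) (Fin r ⊕ Fin m × Fin p) ℝ),
      IsClosed ℬ ∧ (∀ β ∈ ℬ, euclideanOpNorm β ≤ b) ∧
      jointSpectralRadius {A | ∃ β ∈ ℬ, A = 1 + β.transpose * boldα m α} ≤ ENNReal.ofReal ρ ∧
      ∀ x x' : Fin p ⊕ Fin m × Fin p → ℝ, ∃ β ∈ ℬ,
        M.boldMap θ x - M.boldMap θ x' = β.transpose.mulVec (x - x')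

/-- `h(z) = f₀(z) - ∑_{i=1}^{k-1} g_i(z)`. -/
noncomputable def h (M : NLVAR p m) (z : Fin p → ℝ) : Fin p → ℝ :=
  M.f 0 z - ∑ i : Fin m, M.g (i + 1) z

/-- `h̄(ς) = f₀(ς_(1)) - ∑_{i=1}^{k-1} g_i(ς_(i+1))`; a state is `ς = (ς_(1), …, ς_(k))`,
most recent value first. -/
noncomputable def hbar (M : NLVAR p m) (ς : Fin (m + 1) → Fin p → ℝ) : Fin p → ℝ :=
  M.f 0 (ς 0) - ∑ i : Fin m, M.g (i + 1) (ς i.succ)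

/-- `χ(z) = (α_⊥ᵀ h(z), θ(z))`, with `ℝ^p` written as `ℝ^q × ℝ^r`. -/
noncomputable def χ (M : NLVAR p m) {q r : ℕ} (αperp : Matrix (Fin p) (Fin q) ℝ)
    (θ : (Fin p → ℝ) → (Fin r → ℝ)) (z : Fin p → ℝ) : (Fin q → ℝ) × (Fin r → ℝ) :=
  (αperp.transpose.mulVec (M.h z), θ z)

/-- One period of the model: from the state `(z_{t-1}, …, z_{t-k})` and the shock `v = u_t`
to the state `(z_t, …, z_{t-k+1})`. -/
noncomputable def step (M : NLVAR p m) (ς : Fin (m + 1) → Fin p → ℝ) (v : Fin p → ℝ) :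
    Fin (m + 1) → Fin p → ℝ :=
  Fin.cons (Function.invFun (M.f 0) (M.c + ∑ i : Fin (m + 1), M.f i.succ (ς i) + v))
    fun i : Fin m => ς i.castSucc

/-- The state at time `τ + n`, when the state at time `τ - 1` is `ς`, the shock at time `τ` is `u`,
and all later shocks are zero. -/
noncomputable def stateAfter (M : NLVAR p m) (u : Fin p → ℝ) (ς : Fin (m + 1) → Fin p → ℝ) :
    ℕ → Fin (m + 1) → Fin p → ℝ
  | 0 => M.step ς u
  | n + 1 => M.step (M.stateAfter u ς n) 0

/-- `z_{τ+n}(u; ς)`. -/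
noncomputable def path (M : NLVAR p m) (u : Fin p → ℝ) (ς : Fin (m + 1) → Fin p → ℝ) (n : ℕ) :
    Fin p → ℝ :=
  M.stateAfter u ς n 0

/-- `path` is the unique solution of the model from the state `ς` at time `τ - 1`, with the
shock `u` at time `τ` and no shock afterwards. -/
theorem solves_iff_eq_path (M : NLVAR p m) (hf : Function.Bijective (M.f 0)) (u : Fin p → ℝ)
    (ς : Fin (m + 1) → Fin p → ℝ) (τ : ℤ) (z : ℤ → Fin p → ℝ)
    (hς : ∀ i : Fin (m + 1), z (τ - 1 - (i : ℕ)) = ς i) :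
    (∀ n : ℕ, M.f 0 (z (τ + n)) =
        M.c + ∑ i : Fin (m + 1), M.f i.succ (z (τ + n - 1 - (i : ℕ))) + if n = 0 then u else 0) ↔
      ∀ n : ℕ, z (τ + n) = M.path u ς n := by
  have key : ∀ (s : Fin (m + 1) → Fin p → ℝ) (v y : Fin p → ℝ),
      M.f 0 y = M.c + ∑ i : Fin (m + 1), M.f i.succ (s i) + v ↔ y = M.step s v 0 := by
    intro s v y
    simp only [step, Fin.cons_zero]
    constructor
    · intro hy
      rw [← hy, Function.leftInverse_invFun hf.1]
    · intro hy
      rw [hy, Function.rightInverse_invFun hf.2]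
  have hshift : ∀ (N : ℕ), (∀ n < N, z (τ + n) = M.path u ς n) → ∀ i : Fin (m + 1),
      z (τ + N - 1 - (i : ℕ)) = (Nat.rec ς (fun n _ => M.stateAfter u ς n) N :
        Fin (m + 1) → Fin p → ℝ) i := by
    intro N
    induction N with
    | zero => intro _ i; simpa using hς i
    | succ N ih =>
      intro hN i
      have ih' := ih fun n hn => hN n (by omega)
      refine Fin.cases ?_ (fun j => ?_) i
      · have := hN N (by omega)
        simp only [path] at this
        simp only [Fin.val_zero]
        rw [← this]
        congr 1
        push_cast
        ring
      · have h1 := ih' j.castSucc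
        have h2 : M.stateAfter u ς N j.succ = (Nat.rec ς (fun n _ => M.stateAfter u ς n) N :
            Fin (m + 1) → Fin p → ℝ) j.castSucc := by
          cases N <;> simp [stateAfter, step]
        simp only [h2, ← h1]
        congr 1
        simp only [Fin.val_succ, Fin.val_castSucc]
        push_cast
        ring
  have hstep : ∀ (N : ℕ), (∀ n < N, z (τ + n) = M.path u ς n) →
      (M.f 0 (z (τ + N)) =
        M.c + ∑ i : Fin (m + 1), M.f i.succ (z (τ + N - 1 - (i : ℕ))) + (if N = 0 then u else 0) ↔
      z (τ + N) = M.path u ς N) := by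
    intro N hN
    simp only [hshift N hN]
    rw [key]
    cases N <;> simp [path, stateAfter]
  constructor
  · intro hz n
    induction n using Nat.strong_induction_on with
    | _ n ih => exact (hstep n ih).1 (hz n)
  · intro hz n
    exact (hstep n fun j _ => hz j).2 (hz n)

/-- The set of shocks `u` for which `z_t(u; ς)` converges to `z`. -/
def domainOfAttraction (M : NLVAR p m) (z : Fin p → ℝ) (ς : Fin (m + 1) → Fin p → ℝ) :
    Set (Fin p → ℝ) :=
  {u | Tendsto (M.path u ς) atTop (𝓝 z)}

def IsStable (M : NLVAR p m) (S : Set (Fin p → ℝ)) : Prop :=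
  ∀ (u : Fin p → ℝ) (ς : Fin (m + 1) → Fin p → ℝ), ∃ z ∈ S, Tendsto (M.path u ς) atTop (𝓝 z)

def IsNontrivialAttractor (M : NLVAR p m) (z : Fin p → ℝ) : Prop :=
  ∀ ς : Fin (m + 1) → Fin p → ℝ, (M.domainOfAttraction z ς).Nonempty

def IsStrictlyStable (M : NLVAR p m) (S : Set (Fin p → ℝ)) : Prop :=
  M.IsStable S ∧ ∀ z ∈ S, M.IsNontrivialAttractor z

/-- `z_∞(u; ς) = χ⁻¹(α_⊥ᵀ [h̄(ς) + u], -μ)`. -/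
noncomputable def zlim (M : NLVAR p m) {q r : ℕ} (αperp : Matrix (Fin p) (Fin q) ℝ)
    (μ : Fin r → ℝ) (θ : (Fin p → ℝ) → (Fin r → ℝ))
    (u : Fin p → ℝ) (ς : Fin (m + 1) → Fin p → ℝ) : Fin p → ℝ :=
  Function.invFun (M.χ αperp θ) (αperp.transpose.mulVec (M.hbar ς + u), -μ)

/-- The affine subspace `span(α) + [h(z) - h̄(ς)]`. -/
noncomputable def shockSpace (M : NLVAR p m) {r : ℕ} (α : Matrix (Fin p) (Fin r) ℝ)
    (z : Fin p → ℝ) (ς : Fin (m + 1) → Fin p → ℝ) : AffineSubspace ℝ (Fin p → ℝ) :=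
  AffineSubspace.mk' (M.h z - M.hbar ς) (LinearMap.range α.mulVecLin)

end NLVAR

/-- `M_μ = {z : θ(z) = -μ}`. -/
def attractorSpace {p r : ℕ} (μ : Fin r → ℝ) (θ : (Fin p → ℝ) → (Fin r → ℝ)) :
    Set (Fin p → ℝ) :=
  {z | θ z = -μ}

/-! ### The Berger–Wang theorem: from eigenvalues of products to norms of products -/

section MatrixProducts

open scoped Pointwise Matrix.Norms.Operator

variable {n : Type*} [Fintype n] [DecidableEq n]

/-! In the variable `x = (f₀(z_t), ζ_t)`, where `ζ_t` collects the lagged sums of the `g_i`, the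
unshocked model is the first-order recursion `x_{t+1} = x_t + 𝛂 (G(x_t) + (μ, 0))` with `G =
boldMap` (`stackedState_step`). Put `ξ_t = G(x_t) + (μ, 0)`. The increment condition gives `ξ_{t+1}
= (1 + βᵀ 𝛂) ξ_t` with `β ∈ ℬ` depending on `t`. If long products of these matrices contract, then
`ξ_t` is summable, so `x_t` converges and `G = -(μ, 0)` at the limit
(`ContractingIncrements.exists_tendsto`).

The limit is identified by a conserved quantity: `trend` annihilates the range of `𝛂`. At an
equilibrium it equals `α_⊥ᵀ h(z)`, while `G` gives `θ(z) = -μ`; initially it is `α_⊥ᵀ [h̄(ς) + u]`.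
This determines `χ(z)`. Two shocks have the same limit exactly when they differ by an element of
`ker α_⊥ᵀ = span α`.

The map `χ` is onto because the recursion, run with arbitrary `ν` and initial trend, converges to a
preimage. It is injective with continuous inverse because `(trend, G)` expands distances by a
uniform factor: `ker trend` is the range of `𝛂`, and no `βᵀ 𝛂` has a kernel (`exists_norm_sub_le`).

Contraction of products is the Berger–Wang theorem (`exists_norm_products_le_half`). Small spectral
radii give small traces. In the algebra generated by the matrices, an element whose traces against
the algebra all vanish lies in the Jacobson radical, which is nilpotent. So a long product is a
small element plus a radical one, and at most boundedly many radical factors survive in a product of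
these. -/

theorem matrixProducts_eq_pow (𝒜 : Set (Matrix n n ℝ)) (t : ℕ) : matrixProducts 𝒜 t = 𝒜 ^ t := by
  ext B
  rw [Set.mem_pow]
  constructor
  · rintro ⟨M, hM, rfl⟩
    exact ⟨fun s => ⟨M s, hM s⟩, rfl⟩
  · rintro ⟨f, rfl⟩
    exact ⟨fun s => f s, fun s => (f s).2, rfl⟩

/-- The trace is the sum of the complex eigenvalues. Unlike the spectral radius it is linear, which
is what the argument below exploits. -/
theorem abs_trace_le_of_realSpectralRadius_le (B : Matrix n n ℝ) {x : ℝ} (hx : 0 ≤ x)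
    (h : realSpectralRadius B ≤ ENNReal.ofReal x) : |B.trace| ≤ Fintype.card n * x := by
  set C : Matrix n n ℂ := B.map (algebraMap ℝ ℂ) with hC
  have htr : (B.trace : ℂ) = C.charpoly.roots.sum := by
    rw [← Matrix.trace_eq_sum_roots_charpoly, hC]
    simp [Matrix.trace]
  have hroot : ∀ w ∈ C.charpoly.roots.map norm, w ≤ x := by
    intro w hw
    obtain ⟨y, hy, rfl⟩ := Multiset.mem_map.1 hw
    have hy' : y ∈ spectrum ℂ C :=
      Matrix.mem_spectrum_iff_isRoot_charpoly.2 (Polynomial.isRoot_of_mem_roots hy)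
    have h1 : (‖y‖₊ : ENNReal) ≤ ENNReal.ofReal x :=
      (le_iSup₂ (f := fun k (_ : k ∈ spectrum ℂ C) => (‖k‖₊ : ENNReal)) y hy').trans h
    have h2 : ENNReal.ofReal ‖y‖ ≤ ENNReal.ofReal x := by
      rwa [ofReal_norm]
    exact (ENNReal.ofReal_le_ofReal_iff hx).1 h2
  have h3 : ‖C.charpoly.roots.sum‖ ≤ (C.charpoly.roots.map norm).sum :=
    norm_multiset_sum_le _
  have h4 := Multiset.sum_le_card_nsmul _ _ hroot
  have h5 : Multiset.card C.charpoly.roots ≤ Fintype.card n :=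
    (Polynomial.card_roots' _).trans (Matrix.charpoly_natDegree_eq_dim C).le
  rw [Multiset.card_map, nsmul_eq_mul] at h4
  calc |B.trace| = ‖C.charpoly.roots.sum‖ := by rw [← htr]; simp
    _ ≤ Multiset.card C.charpoly.roots * x := h3.trans h4
    _ ≤ Fintype.card n * x := by gcongr

theorem eventually_abs_trace_le (𝒜 : Set (Matrix n n ℝ)) {ρ : ℝ} (hρ : ρ < 1)
    (h : jointSpectralRadius 𝒜 ≤ ENNReal.ofReal ρ) :
    ∃ σ : ℝ, 0 ≤ σ ∧ σ < 1 ∧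
      ∀ᶠ t in atTop, ∀ B ∈ 𝒜 ^ t, |B.trace| ≤ Fintype.card n * σ ^ t := by
  -- The maximum with 0 makes `σ` positive even if `ρ` is negative.
  obtain ⟨σ, hσ, hσ1⟩ := exists_between (max_lt hρ one_pos)
  have hσ0 : 0 < σ := (le_max_right _ _).trans_lt hσ
  refine ⟨σ, hσ0.le, hσ1, ?_⟩
  have hlt : jointSpectralRadius 𝒜 < ENNReal.ofReal σ :=
    h.trans_lt ((ENNReal.ofReal_lt_ofReal_iff hσ0).2 ((le_max_left _ _).trans_lt hσ))
  filter_upwards [eventually_lt_of_limsup_lt hlt, eventually_gt_atTop 0] with t ht ht0 B hB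
  refine abs_trace_le_of_realSpectralRadius_le B (by positivity) ?_
  have h1 : realSpectralRadius B ^ (1 / (t : ℝ)) ≤ ENNReal.ofReal σ := by
    refine le_trans ?_ ht.le
    rw [← matrixProducts_eq_pow] at hB
    exact le_iSup₂ (f := fun B (_ : B ∈ matrixProducts 𝒜 t) =>
      realSpectralRadius B ^ (1 / (t : ℝ))) B hB
  have ht' : (0 : ℝ) < t := by exact_mod_cast ht0
  rw [one_div, ENNReal.rpow_inv_le_iff ht', ENNReal.rpow_natCast, ← ENNReal.ofReal_pow hσ0.le] at h1
  exact h1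

/-- A real matrix all of whose positive powers have trace zero is nilpotent. -/
theorem isNilpotent_of_trace_pow_eq_zero (X : Matrix n n ℝ)
    (h : ∀ k : ℕ, (X ^ (k + 1)).trace = 0) : IsNilpotent X := by
  have hne : minpoly ℝ X ≠ 0 := minpoly.ne_zero (Algebra.IsIntegral.isIntegral X)
  obtain ⟨q, hq, hq0⟩ := Polynomial.exists_eq_pow_rootMultiplicity_mul_and_not_dvd
    (minpoly ℝ X) hne 0
  set k := Polynomial.rootMultiplicity 0 (minpoly ℝ X)
  rw [Polynomial.C_0, sub_zero] at hq hq0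
  -- The exponent is `k + 1`, not `k`, so that `e` below has no constant term even when `k = 0`;
  -- hence `e(X)` has trace zero. Being idempotent, `e(X)` then vanishes, and `q` divides both `e`
  -- and `1 - e`.
  have hcop : IsCoprime (Polynomial.X ^ (k + 1) : Polynomial ℝ) q :=
    ((Polynomial.irreducible_X.coprime_iff_not_dvd).2 hq0).pow_left
  obtain ⟨a, b, hab⟩ := hcop
  set e : Polynomial ℝ := a * Polynomial.X ^ (k + 1)
  have hidem : IsIdempotentElem (Polynomial.aeval X e) := by
    have h1 : Polynomial.aeval X (e * (b * q)) = 0 := by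
      have : e * (b * q) = minpoly ℝ X * (a * b * Polynomial.X) := by
        rw [hq]; ring
      rw [this, map_mul, minpoly.aeval, zero_mul]
    have h2 : e * e = e - e * (b * q) := by
      rw [← eq_sub_iff_add_eq] at hab
      rw [show b * q = 1 - e by rw [hab]; ring]; ring
    rw [IsIdempotentElem, ← map_mul, h2, map_sub, h1, sub_zero]
  have htrace : (Polynomial.aeval X e).trace = 0 := by
    have he : e = Polynomial.X * (a * Polynomial.X ^ k) := by ring
    have : ∀ w : Polynomial ℝ, (Polynomial.aeval X (Polynomial.X * w)).trace = 0 := by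
      intro w
      induction w using Polynomial.induction_on' with
      | add u v hu hv => rw [mul_add, map_add, Matrix.trace_add, hu, hv, add_zero]
      | monomial j c =>
        rw [Polynomial.X_mul_monomial, Polynomial.aeval_monomial, ← Algebra.smul_def,
          Matrix.trace_smul, h, smul_zero]
    rw [he]; exact this _
  have he0 : Polynomial.aeval X e = 0 := by
    have hid : IsIdempotentElem (Matrix.toLin' (Polynomial.aeval X e)) := by
      rw [IsIdempotentElem, Module.End.mul_eq_comp, ← Matrix.toLin'_mul, hidem]
    have := (LinearMap.IsIdempotentElem.trace_eq_zero_iff hid).1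
      (by rw [Matrix.trace_toLin'_eq, htrace])
    simpa using this
  have hdvd : q ∣ e := (Dvd.intro_left _ hq.symm).trans (minpoly.dvd ℝ X he0)
  have hunit : IsUnit q := by
    rw [isUnit_iff_dvd_one, ← hab]
    exact dvd_add hdvd (dvd_mul_left q b)
  refine ⟨k, ?_⟩
  have h0 := minpoly.aeval ℝ X
  rw [hq, map_mul, map_pow, Polynomial.aeval_X] at h0
  exact ((hunit.map (Polynomial.aeval X)).mul_left_eq_zero).1 h0

/-- For each `y`, the positive powers of `y * x` have trace zero by cyclicity, so `y * x` is
nilpotent and `y * x + 1` is a unit. -/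
theorem mem_jacobson_of_trace_mul_eq_zero (𝒮 : Subalgebra ℝ (Matrix n n ℝ)) (x : 𝒮)
    (h : ∀ y : 𝒮, ((x : Matrix n n ℝ) * y).trace = 0) : x ∈ Ring.jacobson 𝒮 := by
  rw [← Ideal.jacobson_bot, Ideal.mem_jacobson_iff]
  intro y
  have hnil : IsNilpotent (y * x) := by
    have : IsNilpotent ((y * x : 𝒮) : Matrix n n ℝ) := by
      refine isNilpotent_of_trace_pow_eq_zero _ fun k => ?_
      have := h ((y * x) ^ k * y)
      rw [Matrix.trace_mul_comm] at this
      rw [← this, pow_succ]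
      push_cast
      simp only [mul_assoc]
    obtain ⟨k, hk⟩ := this
    exact ⟨k, by exact_mod_cast hk⟩
  obtain ⟨u, hu⟩ := hnil.isUnit_add_one
  refine ⟨(↑u⁻¹ : 𝒮), ?_⟩
  have : (↑u⁻¹ : 𝒮) * (y * x + 1) = 1 := by rw [← hu, Units.inv_mul]
  rw [Ideal.mem_bot, mul_assoc, ← this]
  noncomm_ring

/-- In the algebra generated by `𝒜`, an element whose traces against products of elements of `𝒜`
are small is small modulo the Jacobson radical. -/
theorem exists_sub_mem_jacobson_of_trace_le (𝒜 : Set (Matrix n n ℝ)) :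
    ∃ (F : Finset (Matrix n n ℝ)) (c : ℝ), (F : Set (Matrix n n ℝ)) ⊆ Submonoid.closure 𝒜 ∧
      0 ≤ c ∧ ∀ (B : Algebra.adjoin ℝ 𝒜) (δ : ℝ), 0 ≤ δ →
        (∀ C ∈ F, |((B : Matrix n n ℝ) * C).trace| ≤ δ) →
        ∃ S : Algebra.adjoin ℝ 𝒜, B - S ∈ Ring.jacobson (Algebra.adjoin ℝ 𝒜) ∧
          ‖(S : Matrix n n ℝ)‖ ≤ c * δ := by
  obtain ⟨F, hF, hspan⟩ := (Submodule.fg_span_iff_fg_span_finset_subset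
    (R := ℝ) (Submonoid.closure 𝒜 : Set (Matrix n n ℝ))).1 (IsNoetherian.noetherian _)
  set 𝒮 := Algebra.adjoin ℝ 𝒜
  -- `T B` lists the traces of `B` against a finite spanning set of products. With `g` a linear
  -- section of `T` over its range, `S = g (T B)` has size controlled by the traces, and `B - S`
  -- lies in the kernel of `T`, hence in the radical.
  let T : 𝒮 →ₗ[ℝ] (F → ℝ) := LinearMap.pi fun C =>
    Matrix.traceLinearMap n ℝ ℝ ∘ₗ LinearMap.mulRight ℝ (C : Matrix n n ℝ) ∘ₗ 𝒮.val.toLinearMap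
  obtain ⟨s, hs⟩ := T.rangeRestrict.exists_rightInverse_of_surjective T.range_rangeRestrict
  obtain ⟨g, hg⟩ := LinearMap.exists_extend s
  have hgT : ∀ B, T (g (T B)) = T B := fun B => by
    have h1 : T (s (T.rangeRestrict B)) = T B :=
      congrArg Subtype.val (LinearMap.congr_fun hs (T.rangeRestrict B))
    have h2 : g (T B) = s (T.rangeRestrict B) := LinearMap.congr_fun hg (T.rangeRestrict B)
    rw [h2, h1]
  refine ⟨F, ∑ C, ‖(g (Pi.single C 1) : Matrix n n ℝ)‖, hF, by positivity,
    fun B δ hδ hB => ⟨g (T B), ?_, ?_⟩⟩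
  · apply mem_jacobson_of_trace_mul_eq_zero
    intro y
    have h0 : T (B - g (T B)) = 0 := by rw [map_sub, hgT, sub_self]
    have hy : (y : Matrix n n ℝ) ∈ Submodule.span ℝ (F : Set (Matrix n n ℝ)) := by
      rw [← hspan, ← Algebra.adjoin_eq_span]
      exact y.2
    generalize (y : Matrix n n ℝ) = y at hy
    induction hy using Submodule.span_induction with
    | mem C hC => exact congrFun h0 ⟨C, hC⟩
    | zero => simp
    | add u v _ _ hu hv => rw [mul_add, Matrix.trace_add, hu, hv, add_zero]
    | smul a u _ hu => rw [mul_smul_comm, Matrix.trace_smul, hu, smul_zero]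
  · have h1 : (g (T B) : Matrix n n ℝ) = ∑ C, T B C • (g (Pi.single C 1) : Matrix n n ℝ) := by
      conv_lhs => rw [← Finset.univ_sum_single (T B)]
      rw [map_sum]
      push_cast
      refine Finset.sum_congr rfl fun C _ => ?_
      rw [← mul_one (T B C), ← smul_eq_mul, Pi.single_smul, map_smul]
      simp
    rw [h1, Finset.sum_mul]
    refine (norm_sum_le _ _).trans (Finset.sum_le_sum fun C _ => ?_)
    rw [norm_smul, mul_comm]
    gcongr
    exact hB C C.2

/-- Products of perturbations of small elements by elements of a nilpotent ideal decay. -/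
theorem exists_norm_le_of_mem_pow {𝒮 : Subalgebra ℝ (Matrix n n ℝ)} (J : Ideal 𝒮)
    [J.IsTwoSided] {d : ℕ} (hJ : J ^ (d + 1) = ⊥) (ℱ : Set (Matrix n n ℝ)) {K : ℝ} (hK : 0 ≤ K)
    (h : ∀ B ∈ ℱ, ∃ S R : 𝒮, R ∈ J ∧ B = S + R ∧ ‖(S : Matrix n n ℝ)‖ ≤ 1 / 4 ∧
      ‖(R : Matrix n n ℝ)‖ ≤ K) :
    ∃ c : ℝ, ∀ t : ℕ, ∀ P ∈ ℱ ^ t, ‖P‖ ≤ c * (1 / 2) ^ t := by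
  set c₀ : ℝ := ‖(1 : Matrix n n ℝ)‖
  -- `T j` gathers the terms with exactly `j` radical factors. The weight `(4 * K) ^ j` closes the
  -- induction: appending `S` costs `1/4`, and appending `R` costs `K`, which is `1/4` of the extra
  -- weight, so the total factor is at most `1/2`.
  have key : ∀ t : ℕ, ∀ P ∈ ℱ ^ t, ∃ T : ℕ → 𝒮, (∀ j, T j ∈ J ^ j) ∧
      (∀ j, ‖(T j : Matrix n n ℝ)‖ ≤ c₀ * (1 / 2) ^ t * (4 * K) ^ j) ∧
      P = ∑ j ∈ Finset.range (d + 1), (T j : Matrix n n ℝ) := by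
    intro t
    induction t with
    | zero =>
      rintro P hP
      rw [pow_zero, Set.mem_one] at hP
      refine ⟨fun j => if j = 0 then 1 else 0, fun j => ?_, fun j => ?_, ?_⟩
      · rcases j with _ | j <;> simp [Submodule.pow_zero]
      · rcases j with _ | j
        · simp [c₀]
        · simp only [Nat.add_eq_zero_iff, one_ne_zero, and_false, if_false, ZeroMemClass.coe_zero,
            norm_zero]
          positivity
      · rw [Finset.sum_eq_single 0] <;> simp +contextual [hP]
    | succ t ih =>
      rintro P hP
      rw [pow_succ] at hP
      obtain ⟨Q, hQ, B, hB, rfl⟩ := hP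
      obtain ⟨T, hTJ, hTn, rfl⟩ := ih Q hQ
      obtain ⟨S, R, hR, rfl, hSn, hRn⟩ := h B hB
      have hTR : ∀ j, T j * R ∈ J ^ (j + 1) := fun j => by
        rw [Submodule.pow_succ]; exact Ideal.mul_mem_mul (hTJ j) hR
      have hTS : ∀ j, T j * S ∈ J ^ j := fun j => Ideal.mul_mem_right _ _ (hTJ j)
      refine ⟨fun j => Nat.casesOn j (T 0 * S) fun i => T (i + 1) * S + T i * R,
        fun j => ?_, fun j => ?_, ?_⟩
      · rcases j with _ | j
        · exact hTS 0
        · exact add_mem (hTS _) (hTR j)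
      · have hbS : ∀ j, ‖((T j * S : 𝒮) : Matrix n n ℝ)‖ ≤
            c₀ * (1 / 2) ^ t * (4 * K) ^ j * (1 / 4) := fun j => by
          push_cast
          exact (norm_mul_le _ _).trans (mul_le_mul (hTn j) hSn (norm_nonneg _) (by positivity))
        have hbR : ∀ j, ‖((T j * R : 𝒮) : Matrix n n ℝ)‖ ≤
            c₀ * (1 / 2) ^ t * (4 * K) ^ j * K := fun j => by
          push_cast
          exact (norm_mul_le _ _).trans (mul_le_mul (hTn j) hRn (norm_nonneg _) (by positivity))
        rcases j with _ | j
        · refine (hbS 0).trans ?_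
          have : 0 ≤ c₀ * (1 / 2) ^ t * (4 * K) ^ 0 := by positivity
          rw [pow_succ (1 / 2 : ℝ)]
          linarith
        · refine (norm_add_le _ _).trans ((add_le_add (hbS (j + 1)) (hbR j)).trans (le_of_eq ?_))
          rw [pow_succ (1 / 2 : ℝ), pow_succ (4 * K)]
          ring
      · have hlast : T d * R = 0 := by
          have := hTR d
          rwa [hJ, Ideal.mem_bot] at this
        have hlast' : (T d : Matrix n n ℝ) * R = 0 := by exact_mod_cast congrArg Subtype.val hlast
        beta_reduce
        conv_rhs => rw [Finset.sum_range_succ']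
        simp only [Subalgebra.coe_add, Subalgebra.coe_mul, Finset.sum_add_distrib]
        rw [mul_add, Finset.sum_mul, Finset.sum_mul,
          Finset.sum_range_succ' (fun j => (T j : Matrix n n ℝ) * S),
          Finset.sum_range_succ (fun j => (T j : Matrix n n ℝ) * R), hlast', add_zero]
        change _ = _ + (T 0 : Matrix n n ℝ) * S
        abel
  refine ⟨c₀ * ∑ j ∈ Finset.range (d + 1), (4 * K) ^ j, fun t P hP => ?_⟩
  obtain ⟨T, -, hT, rfl⟩ := key t P hP
  refine (norm_sum_le _ _).trans ((Finset.sum_le_sum fun j _ => hT j).trans (le_of_eq ?_))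
  rw [← Finset.mul_sum]
  ring

theorem exists_mem_pow_of_mem_closure {G : Type*} [Monoid G] {s : Set G} {x : G}
    (hx : x ∈ Submonoid.closure s) : ∃ k : ℕ, x ∈ s ^ k := by
  induction hx using Submonoid.closure_induction with
  | mem x hx => exact ⟨1, by simpa⟩
  | one => exact ⟨0, by simp⟩
  | mul x y _ _ hx hy =>
    obtain ⟨k, hk⟩ := hx
    obtain ⟨l, hl⟩ := hy
    exact ⟨k + l, by rw [pow_add]; exact Set.mul_mem_mul hk hl⟩

theorem norm_le_of_mem_pow {R : Type*} [SeminormedRing R] {s : Set R} {K : ℝ} (hK : 0 ≤ K)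
    (hs : ∀ x ∈ s, ‖x‖ ≤ K) (t : ℕ) : ∀ x ∈ s ^ t, ‖x‖ ≤ ‖(1 : R)‖ * K ^ t := by
  induction t with
  | zero => simp +contextual
  | succ t ih =>
    intro x hx
    rw [pow_succ] at hx
    obtain ⟨y, hy, z, hz, rfl⟩ := hx
    refine (norm_mul_le _ _).trans ?_
    rw [pow_succ, ← mul_assoc]
    exact mul_le_mul (ih y hy) (hs z hz) (norm_nonneg _) (by positivity)

/-- The nontrivial half of the Berger–Wang theorem: if a bounded set of matrices has joint
spectral radius (in the sense of eigenvalues) less than one, then all long products contract. -/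
theorem exists_norm_products_le_half {𝒜 : Set (Matrix n n ℝ)} {K : ℝ}
    (hK : ∀ A ∈ 𝒜, ‖A‖ ≤ K) {ρ : ℝ} (hρ : ρ < 1)
    (h : jointSpectralRadius 𝒜 ≤ ENNReal.ofReal ρ) :
    ∃ N : ℕ, 0 < N ∧ ∀ B ∈ 𝒜 ^ N, ‖B‖ ≤ 1 / 2 := by
  wlog hK0 : 0 ≤ K generalizing K
  · exact this (K := |K|) (fun A hA => (hK A hA).trans (le_abs_self K)) (abs_nonneg K)
  obtain ⟨σ, hσ0, hσ1, htr⟩ := eventually_abs_trace_le 𝒜 hρ h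
  obtain ⟨F, c, hF, hc, hdec⟩ := exists_sub_mem_jacobson_of_trace_le 𝒜
  obtain ⟨t₀, ht₀⟩ := eventually_atTop.1 htr
  have hlim : Tendsto (fun t : ℕ => c * (Fintype.card n * σ ^ t)) atTop (𝓝 0) := by
    simpa using ((tendsto_pow_atTop_nhds_zero_of_lt_one hσ0 hσ1).const_mul
      (Fintype.card n : ℝ)).const_mul c
  -- For `B ∈ 𝒜 ^ N` and `C ∈ F` a product of `k` factors, `B * C` lies in `𝒜 ^ (N + k)`, so its
  -- trace is still at most `card n * σ ^ N`. This makes the non-radical part of `B` at most `1/4`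
  -- in norm.
  obtain ⟨N, hN, hNt, hN0⟩ := ((hlim.eventually_le_const (show (0 : ℝ) < 1 / 4 by norm_num)).and
    ((eventually_ge_atTop t₀).and (eventually_gt_atTop 0))).exists
  have hsub : ∀ B ∈ 𝒜 ^ N, B ∈ Algebra.adjoin ℝ 𝒜 := fun B hB =>
    (Algebra.adjoin ℝ 𝒜).toSubmonoid.pow_subset Algebra.subset_adjoin hB
  have : IsArtinianRing (Algebra.adjoin ℝ 𝒜) := IsArtinianRing.of_finite ℝ _
  obtain ⟨d, hd⟩ := IsSemiprimaryRing.isNilpotent (R := Algebra.adjoin ℝ 𝒜)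
  have hd' : Ring.jacobson (Algebra.adjoin ℝ 𝒜) ^ (d + 1) = ⊥ := by
    rw [Submodule.pow_succ, hd, zero_mul]; rfl
  obtain ⟨c', hc'⟩ := exists_norm_le_of_mem_pow (Ring.jacobson (Algebra.adjoin ℝ 𝒜)) hd'
    (𝒜 ^ N) (K := ‖(1 : Matrix n n ℝ)‖ * K ^ N + 1 / 4) (by positivity) (by
      intro B hB
      obtain ⟨S, hS, hSn⟩ := hdec ⟨B, hsub B hB⟩ (Fintype.card n * σ ^ N) (by positivity) (by
        intro C hC
        obtain ⟨k, hk⟩ := exists_mem_pow_of_mem_closure (hF hC)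
        refine (ht₀ (N + k) (by omega) _ (by
          rw [pow_add]; exact Set.mul_mem_mul hB hk)).trans ?_
        gcongr ?_ * ?_
        exact pow_le_pow_of_le_one hσ0 hσ1.le (by omega))
      refine ⟨S, _, hS, by push_cast; abel, hSn.trans hN, ?_⟩
      push_cast
      refine (norm_sub_le _ _).trans ?_
      exact add_le_add (norm_le_of_mem_pow hK0 hK N B hB) (hSn.trans hN))
  have hlim' : Tendsto (fun t : ℕ => c' * (1 / 2) ^ t) atTop (𝓝 0) := by
    simpa using (tendsto_pow_atTop_nhds_zero_of_lt_one (r := (1 / 2 : ℝ)) (by norm_num)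
      (by norm_num)).const_mul c'
  obtain ⟨t, ht, ht0⟩ := ((hlim'.eventually_le_const (show (0 : ℝ) < 1 / 2 by norm_num)).and
    (eventually_gt_atTop 0)).exists
  refine ⟨N * t, Nat.mul_pos hN0 ht0, fun B hB => (hc' t B ?_).trans ht⟩
  rwa [← pow_mul]

end MatrixProducts

/-! ### Recursions driven by maps with contracting increments -/

section IncrementalMap

open scoped Pointwise Matrix.Norms.Operator

variable {X Y : Type*} [Fintype X] [Fintype Y]

theorem exists_norm_le_of_isCompact {ℬ : Set (Matrix X Y ℝ)} (hc : IsCompact ℬ) :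
    ∃ K : ℝ, 0 ≤ K ∧ ∀ β ∈ ℬ, ‖β‖ ≤ K := by
  have hcont : Continuous fun β : Matrix X Y ℝ => ‖β‖ := continuous_norm
  obtain ⟨K, hK⟩ := (hc.image hcont).bddAbove
  exact ⟨max K 0, le_max_right _ _, fun β hβ => (hK ⟨β, hβ, rfl⟩).trans (le_max_left _ _)⟩

variable [DecidableEq Y]

theorem abs_apply_le_euclideanOpNorm (A : Matrix X Y ℝ) (i : X) (j : Y) :
    |A i j| ≤ euclideanOpNorm A := by
  have h := (LinearMap.toContinuousLinearMap (Matrix.toEuclideanLin A)).le_opNorm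
    (EuclideanSpace.single j (1 : ℝ))
  rw [PiLp.norm_single, norm_one, mul_one] at h
  refine le_trans ?_ h
  have h2 := PiLp.norm_apply_le
    (LinearMap.toContinuousLinearMap (Matrix.toEuclideanLin A) (EuclideanSpace.single j (1 : ℝ))) i
  simpa [Matrix.toLpLin_apply] using h2

theorem isCompact_of_euclideanOpNorm_le {ℬ : Set (Matrix X Y ℝ)} (hcl : IsClosed ℬ) {b : ℝ}
    (hb : ∀ β ∈ ℬ, euclideanOpNorm β ≤ b) : IsCompact ℬ := by
  have hbox : IsCompact (Set.pi Set.univ fun _ : X => Set.pi Set.univ fun _ : Y => Set.Icc (-b) b) :=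
    isCompact_univ_pi fun _ => isCompact_univ_pi fun _ => isCompact_Icc
  refine hbox.of_isClosed_subset hcl fun β hβ i _ j _ => ?_
  exact abs_le.1 ((abs_apply_le_euclideanOpNorm β i j).trans (hb β hβ))

/-- Every increment of `G` is of the form `βᵀ (x - x')` with `β` in a set `ℬ`, and long
products of the matrices `1 + βᵀ a` contract. -/
structure ContractingIncrements (G : (X → ℝ) → (Y → ℝ)) (a : Matrix X Y ℝ)
    (ℬ : Set (Matrix X Y ℝ)) : Prop where
  isCompact : IsCompact ℬ
  exists_increment : ∀ x x', ∃ β ∈ ℬ, G x - G x' = β.transpose.mulVec (x - x')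
  exists_contract : ∃ N : ℕ, 0 < N ∧
    ∀ B ∈ {A | ∃ β ∈ ℬ, A = 1 + β.transpose * a} ^ N, ‖B‖ ≤ 1 / 2

variable {G : (X → ℝ) → (Y → ℝ)} {a : Matrix X Y ℝ} {ℬ : Set (Matrix X Y ℝ)}

namespace ContractingIncrements

theorem continuous (h : ContractingIncrements G a ℬ) : Continuous G := by
  obtain ⟨K, hK0, hK⟩ := exists_norm_le_of_isCompact
    (h.isCompact.image (Continuous.matrix_transpose continuous_id))
  refine (LipschitzWith.of_dist_le_mul (K := ⟨K, hK0⟩) fun x x' => ?_).continuous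
  obtain ⟨β, hβ, e⟩ := h.exists_increment x x'
  rw [dist_eq_norm, dist_eq_norm, e]
  refine (Matrix.linfty_opNorm_mulVec _ _).trans ?_
  gcongr
  exact hK _ ⟨β, hβ, rfl⟩

/-- Solutions of `x_{t+1} = x_t + a (G(x_t) + ν)` converge to points where `G = -ν`. -/
theorem exists_tendsto (h : ContractingIncrements G a ℬ) (ν : Y → ℝ) (x : ℕ → X → ℝ)
    (hx : ∀ t, x (t + 1) = x t + a.mulVec (G (x t) + ν)) :
    ∃ x', Tendsto x atTop (𝓝 x') ∧ G x' = -ν := by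
  set 𝒜 : Set (Matrix Y Y ℝ) := {A | ∃ β ∈ ℬ, A = 1 + β.transpose * a} with h𝒜
  set ξ : ℕ → Y → ℝ := fun t => G (x t) + ν with hξ
  have hstep : ∀ t, ∃ A ∈ 𝒜, ξ (t + 1) = A.mulVec (ξ t) := fun t => by
    obtain ⟨β, hβ, e⟩ := h.exists_increment (x (t + 1)) (x t)
    refine ⟨_, ⟨β, hβ, rfl⟩, ?_⟩
    rw [Matrix.add_mulVec, Matrix.one_mulVec, ← Matrix.mulVec_mulVec, ← sub_eq_iff_eq_add']
    have : x (t + 1) - x t = a.mulVec (ξ t) := by rw [hx, add_sub_cancel_left]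
    rw [← this, ← e]
    simp [hξ]
  have hsteps : ∀ s t, ∃ B ∈ 𝒜 ^ s, ξ (t + s) = B.mulVec (ξ t) := fun s => by
    induction s with
    | zero => exact fun t => ⟨1, by simp, by simp⟩
    | succ s ih =>
      intro t
      obtain ⟨B, hB, e⟩ := ih t
      obtain ⟨A, hA, e'⟩ := hstep (t + s)
      refine ⟨A * B, by rw [pow_succ']; exact Set.mul_mem_mul hA hB, ?_⟩
      rw [← add_assoc, e', e, Matrix.mulVec_mulVec]
  obtain ⟨N, hN, hcon⟩ := h.exists_contract
  have hhalf : ∀ t, ‖ξ (t + N)‖ ≤ ‖ξ t‖ / 2 := fun t => by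
    obtain ⟨B, hB, e⟩ := hsteps N t
    rw [e]
    refine (Matrix.linfty_opNorm_mulVec _ _).trans ?_
    have := mul_le_mul_of_nonneg_right (hcon B hB) (norm_nonneg (ξ t))
    linarith
  have hsum : Summable fun t => ‖ξ t‖ := by
    -- With `s_T` the partial sums, `s_T ≤ s_{N+T} ≤ s_N + s_T / 2`, hence `s_T ≤ 2 s_N`.
    refine summable_of_sum_range_le (c := 2 * ∑ t ∈ Finset.range N, ‖ξ t‖)
      (fun _ => norm_nonneg _) fun T => ?_
    have h1 : ∑ t ∈ Finset.range T, ‖ξ t‖ ≤ ∑ t ∈ Finset.range (N + T), ‖ξ t‖ :=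
      Finset.sum_le_sum_of_subset_of_nonneg (Finset.range_mono (by omega))
        fun _ _ _ => norm_nonneg _
    rw [Finset.sum_range_add] at h1
    have h2 : ∑ t ∈ Finset.range T, ‖ξ (N + t)‖ ≤ ∑ t ∈ Finset.range T, ‖ξ t‖ / 2 :=
      Finset.sum_le_sum fun t _ => by rw [add_comm]; exact hhalf t
    rw [← Finset.sum_div] at h2
    linarith
  have hξ0 : Tendsto ξ atTop (𝓝 0) := tendsto_zero_iff_norm_tendsto_zero.2 hsum.tendsto_atTop_zero
  have hsumx : Summable fun t => a.mulVec (ξ t) :=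
    (hsum.mul_left ‖a‖).of_norm_bounded fun t => Matrix.linfty_opNorm_mulVec _ _
  have hxt : ∀ t, x t = x 0 + ∑ s ∈ Finset.range t, a.mulVec (ξ s) := fun t => by
    induction t with
    | zero => simp
    | succ t ih => rw [Finset.sum_range_succ, ← add_assoc, ← ih, hx]
  have hlim : Tendsto x atTop (𝓝 (x 0 + ∑' t, a.mulVec (ξ t))) :=
    (hsumx.hasSum.tendsto_sum_nat.const_add (x 0)).congr fun t => (hxt t).symm
  refine ⟨_, hlim, ?_⟩
  have h1 : Tendsto ξ atTop (𝓝 (G (x 0 + ∑' t, a.mulVec (ξ t)) + ν)) :=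
    ((h.continuous.tendsto _).comp hlim).add_const ν
  exact eq_neg_of_add_eq_zero_left (tendsto_nhds_unique h1 hξ0)

/-- Such an `s` would be fixed by `1 + βᵀ a`, hence by its `N`-th power, which halves norms. -/
theorem eq_zero_of_transpose_mul_mulVec_eq_zero (h : ContractingIncrements G a ℬ)
    {β : Matrix X Y ℝ} (hβ : β ∈ ℬ) {s : Y → ℝ}
    (hs : β.transpose.mulVec (a.mulVec s) = 0) : s = 0 := by
  obtain ⟨N, hN, hcon⟩ := h.exists_contract
  have hfix : ∀ k : ℕ, ((1 + β.transpose * a) ^ k).mulVec s = s := fun k => by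
    induction k with
    | zero => simp
    | succ k ih =>
      rw [pow_succ, ← Matrix.mulVec_mulVec, Matrix.add_mulVec, Matrix.one_mulVec,
        ← Matrix.mulVec_mulVec, hs, add_zero, ih]
  have h1 := Matrix.linfty_opNorm_mulVec ((1 + β.transpose * a) ^ N) s
  rw [hfix] at h1
  have h2 := mul_le_mul_of_nonneg_right
    (hcon _ (Set.pow_mem_pow (n := N) ⟨β, hβ, rfl⟩)) (norm_nonneg s)
  exact norm_eq_zero.1 (le_antisymm (by linarith) (norm_nonneg s))

/-- If `ker P` is contained in the range of `a`, then `x` depends in a Lipschitz manner on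
`(P x, G x)`. -/
theorem exists_norm_sub_le (h : ContractingIncrements G a ℬ) {Z : Type*} [Fintype Z]
    (P : (X → ℝ) →ₗ[ℝ] (Z → ℝ)) (hP : ∀ v, P v = 0 → ∃ s, v = a.mulVec s) :
    ∃ K : ℝ, ∀ x x', ‖x - x'‖ ≤ K * (‖P x - P x'‖ + ‖G x - G x'‖) := by
  have hPc : Continuous P := P.continuous_of_finiteDimensional
  have key : ∃ c : ℝ, 0 < c ∧ ∀ β ∈ ℬ, ∀ v : X → ℝ,
      c * ‖v‖ ≤ ‖P v‖ + ‖β.transpose.mulVec v‖ := by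
    -- Compactness of `ℬ` makes the lower bound uniform in `β`; homogeneity extends it from the unit
    -- sphere.
    have hcomp := h.isCompact.prod (isCompact_sphere (0 : X → ℝ) 1)
    have hφ : Continuous fun w : Matrix X Y ℝ × (X → ℝ) => ‖P w.2‖ + ‖w.1.transpose.mulVec w.2‖ :=
      (hPc.comp continuous_snd).norm.add
        ((continuous_fst.matrix_transpose).matrix_mulVec continuous_snd).norm
    have hpos : ∀ w ∈ ℬ ×ˢ Metric.sphere (0 : X → ℝ) 1,
        0 < ‖P w.2‖ + ‖w.1.transpose.mulVec w.2‖ := by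
      rintro ⟨β, v⟩ ⟨hβ, hv⟩
      by_contra! hle
      have h1 : P v = 0 := norm_eq_zero.1
        (le_antisymm (by linarith [norm_nonneg (β.transpose.mulVec v)]) (norm_nonneg _))
      have h2 : β.transpose.mulVec v = 0 := norm_eq_zero.1
        (le_antisymm (by linarith [norm_nonneg (P v)]) (norm_nonneg _))
      obtain ⟨s, rfl⟩ := hP v h1
      simp [h.eq_zero_of_transpose_mul_mulVec_eq_zero hβ h2] at hv
    obtain ⟨c, hc0, hc⟩ := hcomp.exists_forall_le' hφ.continuousOn hpos
    refine ⟨c, hc0, fun β hβ v => ?_⟩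
    rcases eq_or_ne v 0 with rfl | hv
    · simp
    have hv0 : 0 < ‖v‖ := norm_pos_iff.2 hv
    have h1 := hc (β, ‖v‖⁻¹ • v) ⟨hβ, by simp [norm_smul, hv0.ne']⟩
    simp only [map_smul, Matrix.mulVec_smul, norm_smul, norm_inv, norm_norm, ← mul_add] at h1
    rwa [le_inv_mul_iff₀ hv0, mul_comm] at h1
  obtain ⟨c, hc0, hc⟩ := key
  refine ⟨c⁻¹, fun x x' => ?_⟩
  obtain ⟨β, hβ, e⟩ := h.exists_increment x x'
  rw [le_inv_mul_iff₀ hc0, e, ← map_sub]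
  exact hc β hβ _

end ContractingIncrements

end IncrementalMap

theorem Matrix.injective_mulVec_of_rank_eq {p r : ℕ} {A : Matrix (Fin p) (Fin r) ℝ}
    (h : A.rank = r) : Function.Injective A.mulVec := by
  have h1 := LinearMap.finrank_range_add_finrank_ker A.mulVecLin
  rw [show Module.finrank ℝ (LinearMap.range A.mulVecLin) = r from h, Module.finrank_fin_fun] at h1
  have h2 : LinearMap.ker A.mulVecLin = ⊥ := Submodule.finrank_eq_zero.1 (by omega)
  exact LinearMap.ker_eq_bot.1 h2

/-! ### Linear algebra of the orthogonal complement -/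

section Complement

variable {p q r : ℕ} {α : Matrix (Fin p) (Fin r) ℝ} {αperp : Matrix (Fin p) (Fin q) ℝ}

theorem Matrix.surjective_transpose_mulVec_of_rank_eq (h : αperp.rank = q) :
    Function.Surjective αperp.transpose.mulVec := by
  have h1 : LinearMap.range αperp.transpose.mulVecLin = ⊤ := by
    apply Submodule.eq_top_of_finrank_eq
    rw [Module.finrank_fin_fun]
    exact (Matrix.rank_transpose αperp).trans h
  exact LinearMap.range_eq_top.1 h1

theorem Matrix.transpose_mulVec_eq_zero_iff (hpq : q + r = p) (hα : α.rank = r)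
    (hrank : αperp.rank = q) (hperp : αperp.transpose * α = 0) (v : Fin p → ℝ) :
    αperp.transpose.mulVec v = 0 ↔ v ∈ LinearMap.range α.mulVecLin := by
  have hle : LinearMap.range α.mulVecLin ≤ LinearMap.ker αperp.transpose.mulVecLin := by
    rintro _ ⟨s, rfl⟩
    rw [LinearMap.mem_ker, Matrix.mulVecLin_apply, Matrix.mulVecLin_apply, Matrix.mulVec_mulVec,
      hperp, Matrix.zero_mulVec]
  have h1 := LinearMap.finrank_range_add_finrank_ker αperp.transpose.mulVecLin
  have h2 : Module.finrank ℝ (LinearMap.range αperp.transpose.mulVecLin) = q :=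
    (Matrix.rank_transpose αperp).trans hrank
  rw [h2, Module.finrank_fin_fun] at h1
  have h3 : Module.finrank ℝ (LinearMap.range α.mulVecLin) = r := hα
  rw [Submodule.eq_of_le_of_finrank_eq hle (by omega)]
  rfl

end Complement

/-! ### The stacked first-order form of the model -/

namespace NLVAR

variable {p m : ℕ}

theorem g_eq_zero (M : NLVAR p m) {j : ℕ} (hj : m < j) (z : Fin p → ℝ) : M.g j z = 0 := by
  rw [g, Finset.filter_false_of_mem fun i _ => by have := i.2; omega]
  simp

theorem g_succ_sub_g (M : NLVAR p m) (i : Fin (m + 1)) (z : Fin p → ℝ) :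
    M.g (i + 1) z - M.g i z = M.f i.succ z := by
  have h : Finset.univ.filter (fun l : Fin (m + 1) => (i : ℕ) ≤ l) =
      insert i (Finset.univ.filter fun l : Fin (m + 1) => (i : ℕ) + 1 ≤ l) := by
    ext l
    simp only [Finset.mem_filter, Finset.mem_univ, true_and, Finset.mem_insert, Fin.ext_iff]
    omega
  rw [g, g, h, Finset.sum_insert (by simp)]
  abel

theorem g_zero (M : NLVAR p m) (z : Fin p → ℝ) : M.g 0 z = -∑ i : Fin (m + 1), M.f i.succ z := by
  simp [g]

/-- The `j`-th block `∑_{i > j} g_i(z_{t-i+j})` of the lower part of the state of the stacked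
system. -/
noncomputable def lagSum (M : NLVAR p m) (ς : Fin (m + 1) → Fin p → ℝ) (j : ℕ) : Fin p → ℝ :=
  ∑ s : Fin m, M.g (j + s + 1) (ς s.succ)

theorem lagSum_eq_zero (M : NLVAR p m) (ς : Fin (m + 1) → Fin p → ℝ) {j : ℕ} (hj : m ≤ j) :
    M.lagSum ς j = 0 :=
  Finset.sum_eq_zero fun _ _ => M.g_eq_zero (by omega) _

/-- Both sides are the sum of `g_{j+s+1}(ς_s)` over all `m + 1` lags, split at the last or at the
first term; the last one vanishes. -/
theorem lagSum_cons (M : NLVAR p m) (ς : Fin (m + 1) → Fin p → ℝ) (y : Fin p → ℝ) (j : ℕ) :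
    M.lagSum (Fin.cons y fun i : Fin m => ς i.castSucc : Fin (m + 1) → Fin p → ℝ) j =
      M.g (j + 1) (ς 0) + M.lagSum ς (j + 1) := by
  have h1 := Fin.sum_univ_castSucc fun s : Fin (m + 1) => M.g (j + s + 1) (ς s)
  have h2 := Fin.sum_univ_succ fun s : Fin (m + 1) => M.g (j + s + 1) (ς s)
  rw [h1, Fin.val_last, M.g_eq_zero (by omega), add_zero] at h2
  simp only [lagSum, Fin.cons_succ]
  simp only [Fin.val_castSucc, Fin.val_succ, Fin.val_zero, add_zero] at h2
  rw [h2]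
  simp only [add_comm, add_left_comm]

/-- The state `(f₀(z_t), ζ_t)` of the stacked first-order system. -/
noncomputable def stackedState (M : NLVAR p m) (ς : Fin (m + 1) → Fin p → ℝ) :
    Fin p ⊕ Fin m × Fin p → ℝ :=
  Sum.elim (M.f 0 (ς 0)) fun x => M.lagSum ς x.1 x.2

/-- Block vectors are written as sequences on `ℕ`, so the case `m = 0`, where there is no first
block, needs `w 0 = 0`. -/
theorem blockE_transpose_mulVec (w : ℕ → Fin p → ℝ) (hw : m = 0 → w 0 = 0) :
    (blockE p m).transpose.mulVec (fun x : Fin m × Fin p => w x.1 x.2) = w 0 := by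
  ext b
  rcases m with _ | m
  · simp [Matrix.mulVec, dotProduct, hw]
  · simp only [Matrix.mulVec, dotProduct, Fintype.sum_prod_type, Matrix.transpose_apply, blockE,
      Matrix.of_apply, Fin.sum_univ_succ]
    simp

theorem blockD_mulVec (w : ℕ → Fin p → ℝ) (hw : w m = 0) (x : Fin m × Fin p) :
    (blockD p m).mulVec (fun x : Fin m × Fin p => w x.1 x.2) x =
      w (x.1 + 1) x.2 - w x.1 x.2 := by
  obtain ⟨j, b⟩ := x
  have h1 : (blockD p m).mulVec (fun x : Fin m × Fin p => w x.1 x.2) (j, b) =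
      ∑ i : Fin m, ((if (i : ℕ) = j + 1 then w i b else 0) - if i = j then w i b else 0) := by
    simp only [Matrix.mulVec, dotProduct, Fintype.sum_prod_type, blockD, Matrix.of_apply]
    refine Finset.sum_congr rfl fun i _ => ?_
    rw [Finset.sum_eq_single b (fun c _ hc => by simp [hc.symm]) (by simp)]
    by_cases hij : j = i
    · subst hij; simp
    · simp [hij, Ne.symm hij]
  rw [h1, Finset.sum_sub_distrib]
  congr 1
  · by_cases hj : (j : ℕ) + 1 < m
    · rw [Finset.sum_eq_single ⟨j + 1, hj⟩ (fun i _ hi => ?_) (by simp)]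
      · simp
      · rw [if_neg fun h => hi (Fin.ext h)]
    · have : (j : ℕ) + 1 = m := by omega
      rw [this, hw]
      exact Finset.sum_eq_zero fun i _ => if_neg (by omega)
  · simp

/-- Extended by zero beyond `m`, the blocks of `D v` are consecutive differences, and their sum
telescopes. -/
theorem sum_blockD_mulVec (v : Fin m × Fin p → ℝ) :
    ∑ i : Fin m, (fun b => (blockD p m).mulVec v (i, b)) = -(blockE p m).transpose.mulVec v := by
  obtain ⟨w, hw, rfl⟩ : ∃ w : ℕ → Fin p → ℝ, (∀ j, m ≤ j → w j = 0) ∧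
      v = fun x : Fin m × Fin p => w x.1 x.2 := by
    refine ⟨fun j b => if h : j < m then v (⟨j, h⟩, b) else 0, fun j hj => ?_, ?_⟩
    · ext b; simp [hj]
    · ext x; simp
  rw [blockE_transpose_mulVec w fun h => hw 0 (by omega)]
  simp only [blockD_mulVec w (hw m le_rfl)]
  rw [Fin.sum_univ_eq_sum_range (fun i => fun b => w (i + 1) b - w i b)]
  have := Finset.sum_range_sub w m
  rw [hw m le_rfl, zero_sub] at this
  exact this

section Stacked

variable {r : ℕ} (M : NLVAR p m) (α : Matrix (Fin p) (Fin r) ℝ) (θ : (Fin p → ℝ) → (Fin r → ℝ))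

theorem boldMap_inl (x : Fin p ⊕ Fin m × Fin p → ℝ) (a : Fin r) :
    M.boldMap θ x (Sum.inl a) = θ (Function.invFun (M.f 0) fun a => x (Sum.inl a)) a := by
  simp [boldMap, boldθ, boldD₀, Matrix.fromBlocks_mulVec]

theorem boldMap_inr (x : Fin p ⊕ Fin m × Fin p → ℝ) (y : Fin m × Fin p) :
    M.boldMap θ x (Sum.inr y) =
      M.g (y.1 + 1) (Function.invFun (M.f 0) fun a => x (Sum.inl a)) y.2 +
        (blockD p m).mulVec (fun y => x (Sum.inr y)) y := by
  simp only [boldMap, boldθ, boldD₀, Matrix.fromBlocks_mulVec, Pi.add_apply, Sum.elim_inr,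
    Matrix.zero_mulVec, zero_add]
  rfl

theorem boldMap_stackedState (hf : Function.Injective (M.f 0)) (ς : Fin (m + 1) → Fin p → ℝ) :
    M.boldMap θ (M.stackedState ς) = Sum.elim (θ (ς 0)) fun y =>
      M.g (y.1 + 1) (ς 0) y.2 + M.lagSum ς (y.1 + 1) y.2 - M.lagSum ς y.1 y.2 := by
  have h0 : (Function.invFun (M.f 0) fun a => M.stackedState ς (Sum.inl a)) = ς 0 :=
    Function.leftInverse_invFun hf (ς 0)
  ext y
  rcases y with a | y
  · rw [boldMap_inl, h0]; rfl
  · rw [boldMap_inr, h0, Sum.elim_inr, add_sub_assoc]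
    congr 1
    exact blockD_mulVec (M.lagSum ς) (M.lagSum_eq_zero ς le_rfl) y

theorem boldα_mulVec (s : Fin r → ℝ) (v : Fin m × Fin p → ℝ) :
    (boldα m α).mulVec (Sum.elim s v) =
      Sum.elim (α.mulVec s + (blockE p m).transpose.mulVec v) v := by
  simp [boldα, Matrix.fromBlocks_mulVec, Function.comp_def]

/-- The stacked first-order form of the model. -/
theorem stackedState_step (hf : Function.Bijective (M.f 0)) {μ : Fin r → ℝ}
    (hμ : M.c = α.mulVec μ) (hθ : ∀ z, M.eqmap z = α.mulVec (θ z))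
    (ς : Fin (m + 1) → Fin p → ℝ) (v : Fin p → ℝ) :
    M.stackedState (M.step ς v) = M.stackedState ς +
      (boldα m α).mulVec (M.boldMap θ (M.stackedState ς) + Sum.elim μ 0) + Sum.elim v 0 := by
  -- Summation by parts through `f_i = g_i - g_{i-1}`. The bracket is the first lower block of
  -- `boldMap`, which `Eᵀ` extracts.
  have hlag : ∑ i : Fin (m + 1), M.f i.succ (ς i) = M.f 0 (ς 0) + M.eqmap (ς 0) +
      (M.g 1 (ς 0) + M.lagSum ς 1 - M.lagSum ς 0) := by
    have h1 : M.lagSum ς 1 - M.lagSum ς 0 = ∑ s : Fin m, M.f s.succ.succ (ς s.succ) := by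
      rw [lagSum, lagSum, ← Finset.sum_sub_distrib]
      refine Finset.sum_congr rfl fun s _ => ?_
      rw [← M.g_succ_sub_g s.succ]
      simp only [Fin.val_succ, add_comm, add_left_comm, add_zero]
    have h2 := M.g_succ_sub_g 0 (ς 0)
    have h3 := M.g_zero (ς 0)
    simp only [Fin.val_zero, zero_add] at h2
    rw [Fin.sum_univ_succ, ← h1, ← h2, h3, eqmap]
    abel
  have hE := blockE_transpose_mulVec (p := p) (m := m)
    (fun j => M.g (j + 1) (ς 0) + M.lagSum ς (j + 1) - M.lagSum ς j) (by
      rintro rfl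
      simp [M.g_eq_zero, M.lagSum_eq_zero])
  rw [M.boldMap_stackedState θ hf.1, ← Sum.elim_add_add, add_zero, boldα_mulVec]
  ext y
  rcases y with a | y
  · have h4 : M.f 0 (M.step ς v 0) = M.c + ∑ i : Fin (m + 1), M.f i.succ (ς i) + v := by
      simp only [step, Fin.cons_zero]
      exact Function.rightInverse_invFun hf.2 _
    simp only [stackedState, Sum.elim_inl, Pi.add_apply]
    rw [h4, hlag, hμ, hθ, Matrix.mulVec_add]
    simp only [Pi.add_apply, Pi.sub_apply] at hE ⊢
    rw [hE]
    simp only [Pi.add_apply, Pi.sub_apply, zero_add]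
    ring
  · simp only [stackedState, Sum.elim_inr, Pi.add_apply, Pi.zero_apply, add_zero]
    rw [step, lagSum_cons, Pi.add_apply]
    ring

theorem lagSum_const (z : Fin p → ℝ) (j : ℕ) :
    M.lagSum (fun _ => z) j = M.g (j + 1) z + M.lagSum (fun _ => z) (j + 1) := by
  rw [← M.lagSum_cons (fun _ => z) z j]
  congr 1
  ext i : 1
  refine Fin.cases rfl (fun _ => rfl) i

theorem boldMap_stackedState_const (hf : Function.Injective (M.f 0)) (z : Fin p → ℝ) :
    M.boldMap θ (M.stackedState fun _ => z) = Sum.elim (θ z) 0 := by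
  rw [M.boldMap_stackedState θ hf]
  congr 1
  ext y
  rw [M.lagSum_const z y.1, Pi.add_apply, sub_self, Pi.zero_apply]

end Stacked

/-- The linear map `(z, ζ) ↦ α_⊥ᵀ (z - Eᵀ ζ)`. -/
noncomputable def trend (m : ℕ) {q : ℕ} (αperp : Matrix (Fin p) (Fin q) ℝ) :
    (Fin p ⊕ Fin m × Fin p → ℝ) →ₗ[ℝ] (Fin q → ℝ) :=
  αperp.transpose.mulVecLin ∘ₗ (LinearMap.funLeft ℝ ℝ Sum.inl -
    (blockE p m).transpose.mulVecLin ∘ₗ LinearMap.funLeft ℝ ℝ Sum.inr)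

/-! ### The conserved trend component -/

section Trend

variable {q r : ℕ} (M : NLVAR p m) {α : Matrix (Fin p) (Fin r) ℝ}
  {αperp : Matrix (Fin p) (Fin q) ℝ}

theorem trend_elim (w : Fin p → ℝ) (v : Fin m × Fin p → ℝ) :
    trend m αperp (Sum.elim w v) =
      αperp.transpose.mulVec (w - (blockE p m).transpose.mulVec v) := rfl

theorem trend_boldα (hperp : αperp.transpose * α = 0) (s : Fin r ⊕ Fin m × Fin p → ℝ) :
    trend m αperp ((boldα m α).mulVec s) = 0 := by
  obtain ⟨s, v, rfl⟩ : ∃ u v, s = Sum.elim u v :=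
    ⟨s ∘ Sum.inl, s ∘ Sum.inr, (Sum.elim_comp_inl_inr s).symm⟩
  rw [boldα_mulVec, trend_elim, add_sub_cancel_right, Matrix.mulVec_mulVec, hperp,
    Matrix.zero_mulVec]

theorem exists_boldα_of_trend_eq_zero (hpq : q + r = p) (hα : α.rank = r)
    (hrank : αperp.rank = q) (hperp : αperp.transpose * α = 0)
    (x : Fin p ⊕ Fin m × Fin p → ℝ) (hx : trend m αperp x = 0) :
    ∃ s, x = (boldα m α).mulVec s := by
  obtain ⟨w, v, rfl⟩ : ∃ u v, x = Sum.elim u v :=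
    ⟨x ∘ Sum.inl, x ∘ Sum.inr, (Sum.elim_comp_inl_inr x).symm⟩
  rw [trend_elim, Matrix.transpose_mulVec_eq_zero_iff hpq hα hrank hperp] at hx
  obtain ⟨s, hs⟩ := hx
  rw [Matrix.mulVecLin_apply] at hs
  exact ⟨Sum.elim s v, by rw [boldα_mulVec, hs, sub_add_cancel]⟩

theorem trend_stackedState (ς : Fin (m + 1) → Fin p → ℝ) :
    trend m αperp (M.stackedState ς) = αperp.transpose.mulVec (M.hbar ς) := by
  rw [stackedState, trend_elim, blockE_transpose_mulVec _ fun h => M.lagSum_eq_zero ς h.le]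
  simp [hbar, lagSum]

/-- At an equilibrium of the lower blocks, the trend component is `α_⊥ᵀ h`. -/
theorem trend_eq_of_boldMap_eq (hf : Function.Surjective (M.f 0))
    (θ : (Fin p → ℝ) → (Fin r → ℝ)) (x : Fin p ⊕ Fin m × Fin p → ℝ) {ν : Fin r → ℝ}
    (hx : M.boldMap θ x = Sum.elim ν 0) :
    trend m αperp x =
      αperp.transpose.mulVec (M.h (Function.invFun (M.f 0) fun a => x (Sum.inl a))) := by
  obtain ⟨w, v, rfl⟩ : ∃ u v, x = Sum.elim u v :=
    ⟨x ∘ Sum.inl, x ∘ Sum.inr, (Sum.elim_comp_inl_inr x).symm⟩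
  have h1 : ∑ i : Fin m, M.g (i + 1) (Function.invFun (M.f 0) w) =
      (blockE p m).transpose.mulVec v := by
    rw [← neg_eq_iff_eq_neg.2 (sum_blockD_mulVec v), ← Finset.sum_neg_distrib]
    refine Finset.sum_congr rfl fun i _ => funext fun b => ?_
    have := congrFun hx (Sum.inr (i, b))
    rw [boldMap_inr] at this
    exact eq_neg_of_add_eq_zero_left this
  simp only [Sum.elim_inl]
  rw [trend_elim, h, h1, Function.rightInverse_invFun hf w]

theorem hbar_const (z : Fin p → ℝ) : M.hbar (fun _ => z) = M.h z := rfl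

end Trend

end NLVAR

/-! ### Convergence of paths and the homeomorphism `χ` -/

namespace NLVAR

variable {p m q r : ℕ} {M : NLVAR p m} {α : Matrix (Fin p) (Fin r) ℝ}
  {αperp : Matrix (Fin p) (Fin q) ℝ} {θ : (Fin p → ℝ) → (Fin r → ℝ)}
  {ℬ : Set (Matrix (Fin p ⊕ Fin m × Fin p) (Fin r ⊕ Fin m × Fin p) ℝ)}

theorem InCVAR.exists_contractingIncrements {b ρ : ℝ} (hM : M.InCVAR α b ρ)
    (hθ : ∀ z, M.eqmap z = α.mulVec (θ z)) :
    ∃ ℬ, ContractingIncrements (M.boldMap θ) (boldα m α) ℬ := by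
  obtain ⟨hrank, -, hρ, -, μ', θ', -, hθ', ℬ, hcl, hb, hjsr, hinc⟩ := hM
  -- Full column rank of `α` makes `θ` unique, so the `θ` of the assumption is the given one.
  obtain rfl : θ' = θ := funext fun z =>
    Matrix.injective_mulVec_of_rank_eq hrank ((hθ' z).symm.trans (hθ z))
  have hcomp := isCompact_of_euclideanOpNorm_le hcl hb
  have hcomp' : IsCompact {A | ∃ β ∈ ℬ, A = 1 + β.transpose * boldα m α} := by
    have hc : Continuous fun β : Matrix (Fin p ⊕ Fin m × Fin p) (Fin r ⊕ Fin m × Fin p) ℝ =>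
        1 + β.transpose * boldα m α :=
      continuous_const.add ((Continuous.matrix_transpose continuous_id).matrix_mul continuous_const)
    convert hcomp.image hc using 1
    ext A
    simp [eq_comm]
  obtain ⟨K, -, hK⟩ := exists_norm_le_of_isCompact hcomp'
  exact ⟨ℬ, hcomp, hinc, exists_norm_products_le_half hK hρ hjsr⟩

theorem continuous_χ (hf : IsHomeomorph (M.f 0)) (hG : Continuous (M.boldMap θ)) :
    Continuous (M.χ αperp θ) := by
  -- At `(f₀(z), 0)` the map `boldMap` returns `θ(z)` and the `g_i(z)`, so these inherit its
  -- continuity.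
  have hext : Continuous fun z => (Sum.elim (M.f 0 z) 0 : Fin p ⊕ Fin m × Fin p → ℝ) := by
    refine continuous_pi fun y => ?_
    rcases y with a | y
    · exact (continuous_apply a).comp hf.continuous
    · exact continuous_const
  have hinv : ∀ z, Function.invFun (M.f 0) (M.f 0 z) = z :=
    Function.leftInverse_invFun hf.injective
  have hθc : Continuous θ := continuous_pi fun a => by
    refine ((continuous_apply (Sum.inl a)).comp (hG.comp hext)).congr fun z => ?_
    rw [Function.comp_apply, Function.comp_apply, boldMap_inl]
    exact congrFun (congrArg θ (hinv z)) a
  have hgc : ∀ i : Fin m, Continuous (M.g (i + 1)) := fun i => continuous_pi fun b => by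
    refine ((continuous_apply (Sum.inr (i, b))).comp (hG.comp hext)).congr fun z => ?_
    rw [Function.comp_apply, Function.comp_apply, boldMap_inr]
    simp only [Sum.elim_inl, Sum.elim_inr, hinv, Pi.zero_apply]
    change _ + (blockD p m).mulVec 0 _ = _
    simp
  have hh : Continuous M.h := hf.continuous.sub (continuous_finsetSum _ fun i _ => hgc i)
  exact (continuous_const.matrix_mulVec hh).prodMk hθc

/-- Solutions of the stacked system converge, and their limits are determined by `χ`. -/
theorem exists_tendsto_stacked (hf : IsHomeomorph (M.f 0))
    (hℬ : ContractingIncrements (M.boldMap θ) (boldα m α) ℬ)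
    (hperp : αperp.transpose * α = 0) (ν : Fin r → ℝ) (x : ℕ → Fin p ⊕ Fin m × Fin p → ℝ)
    (hx : ∀ t, x (t + 1) = x t + (boldα m α).mulVec (M.boldMap θ (x t) + Sum.elim ν 0)) :
    ∃ z, Tendsto (fun t a => x t (Sum.inl a)) atTop (𝓝 (M.f 0 z)) ∧
      M.χ αperp θ z = (trend m αperp (x 0), -ν) := by
  obtain ⟨x', hlim, hG⟩ := hℬ.exists_tendsto (Sum.elim ν 0) x hx
  have hG' : M.boldMap θ x' = Sum.elim (-ν) 0 := by
    rw [hG]; ext y; rcases y with a | y <;> simp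
  have htr : ∀ t, trend m αperp (x t) = trend m αperp (x 0) := fun t => by
    induction t with
    | zero => rfl
    | succ t ih => rw [hx, map_add, trend_boldα hperp, add_zero, ih]
  have htr' : trend m αperp x' = trend m αperp (x 0) := by
    refine tendsto_nhds_unique
      (((trend m αperp).continuous_of_finiteDimensional.tendsto x').comp hlim) ?_
    exact tendsto_const_nhds.congr fun t => (htr t).symm
  refine ⟨Function.invFun (M.f 0) fun a => x' (Sum.inl a), ?_, Prod.ext ?_ ?_⟩
  · rw [Function.rightInverse_invFun hf.surjective]
    exact tendsto_pi_nhds.2 fun a => tendsto_pi_nhds.1 hlim (Sum.inl a)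
  · rw [← htr', M.trend_eq_of_boldMap_eq hf.surjective θ x' hG']
    rfl
  · ext a
    exact (M.boldMap_inl θ x' a).symm.trans (congrFun hG' (Sum.inl a))

theorem isHomeomorph_χ (hf : IsHomeomorph (M.f 0))
    (hℬ : ContractingIncrements (M.boldMap θ) (boldα m α) ℬ) (hpq : q + r = p)
    (hα : α.rank = r) (hrank : αperp.rank = q) (hperp : αperp.transpose * α = 0) :
    IsHomeomorph (M.χ αperp θ) := by
  obtain ⟨K, hK⟩ := hℬ.exists_norm_sub_le (trend m αperp)
    (exists_boldα_of_trend_eq_zero hpq hα hrank hperp)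
  -- At the stacked form of a constant state, `trend` and `boldMap` are `α_⊥ᵀ h(z)` and `(θ(z), 0)`,
  -- the two components of `χ(z)`; each contributes one unit to the factor 2.
  have hlip : ∀ z z', ‖M.f 0 z - M.f 0 z'‖ ≤ |K| * 2 * ‖M.χ αperp θ z - M.χ αperp θ z'‖ := by
    intro z z'
    have h1 := hK (M.stackedState fun _ => z) (M.stackedState fun _ => z')
    rw [M.boldMap_stackedState_const θ hf.injective, M.boldMap_stackedState_const θ hf.injective,
      M.trend_stackedState, M.trend_stackedState, hbar_const, hbar_const] at h1
    have h2 : ‖M.f 0 z - M.f 0 z'‖ ≤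
        ‖(M.stackedState fun _ => z) - M.stackedState fun _ => z'‖ :=
      (pi_norm_le_iff_of_nonneg (norm_nonneg _)).2 fun a =>
        norm_le_pi_norm ((M.stackedState fun _ => z) - M.stackedState fun _ => z') (Sum.inl a)
    have h3 : ‖(Sum.elim (θ z) 0 - Sum.elim (θ z') 0 : Fin r ⊕ Fin m × Fin p → ℝ)‖ ≤
        ‖M.χ αperp θ z - M.χ αperp θ z'‖ := by
      refine le_trans ((pi_norm_le_iff_of_nonneg (norm_nonneg _)).2 fun y => ?_)
        (norm_snd_le (M.χ αperp θ z - M.χ αperp θ z'))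
      rcases y with a | y
      · exact norm_le_pi_norm (θ z - θ z') a
      · simp
    have h4 : ‖αperp.transpose.mulVec (M.h z) - αperp.transpose.mulVec (M.h z')‖ ≤
        ‖M.χ αperp θ z - M.χ αperp θ z'‖ := norm_fst_le (M.χ αperp θ z - M.χ αperp θ z')
    refine h2.trans (h1.trans ?_)
    rw [mul_assoc]
    gcongr
    · exact le_abs_self K
    · linarith
  have hinj : Function.Injective (M.χ αperp θ) := fun z z' h => by
    have := hlip z z'
    rw [h, sub_self, norm_zero, mul_zero] at this
    exact hf.injective (sub_eq_zero.1 (norm_le_zero_iff.1 this))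
  have hsurj : Function.Surjective (M.χ αperp θ) := by
    rintro ⟨y, ν⟩
    -- The recursion started at `(w, 0)` has trend `α_⊥ᵀ w = y`, and its limit solves `χ z = (y,
    -- ν)`.
    obtain ⟨w, rfl⟩ := Matrix.surjective_transpose_mulVec_of_rank_eq hrank y
    obtain ⟨z, -, hz⟩ := exists_tendsto_stacked hf hℬ hperp (-ν)
      (Nat.rec (Sum.elim w 0) fun _ x =>
        x + (boldα m α).mulVec (M.boldMap θ x + Sum.elim (-ν) 0)) fun _ => rfl
    refine ⟨z, hz.trans ?_⟩
    rw [neg_neg]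
    congr 1
    simp [trend_elim]
  rw [isHomeomorph_iff_exists_inverse]
  refine ⟨continuous_χ hf hℬ.continuous, Function.invFun (M.χ αperp θ),
    Function.leftInverse_invFun hinj, Function.rightInverse_invFun hsurj, ?_⟩
  -- Only `f₀ ∘ χ⁻¹` is shown to be Lipschitz; continuity of `χ⁻¹` follows since `f₀` is a
  -- homeomorphism.
  rw [hf.isInducing.continuous_iff]
  refine (LipschitzWith.of_dist_le_mul (K := ⟨|K| * 2, by positivity⟩) fun y y' => ?_).continuous
  have := hlip (Function.invFun (M.χ αperp θ) y) (Function.invFun (M.χ αperp θ) y')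
  rw [Function.rightInverse_invFun hsurj, Function.rightInverse_invFun hsurj] at this
  rwa [dist_eq_norm, dist_eq_norm]

theorem exists_tendsto_path (hf : IsHomeomorph (M.f 0))
    (hℬ : ContractingIncrements (M.boldMap θ) (boldα m α) ℬ)
    (hperp : αperp.transpose * α = 0) {μ : Fin r → ℝ} (hμ : M.c = α.mulVec μ)
    (hθ : ∀ z, M.eqmap z = α.mulVec (θ z)) (u : Fin p → ℝ) (ς : Fin (m + 1) → Fin p → ℝ) :
    ∃ z, Tendsto (M.path u ς) atTop (𝓝 z) ∧
      M.χ αperp θ z = (αperp.transpose.mulVec (M.hbar ς + u), -μ) := by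
  have hstep := M.stackedState_step α θ hf.bijective hμ hθ
  obtain ⟨z, hz, hχ⟩ := exists_tendsto_stacked hf hℬ hperp μ
    (fun t => M.stackedState (M.stateAfter u ς t)) fun t => by
      rw [stateAfter, hstep, add_eq_left]
      ext y; rcases y with a | y <;> rfl
  refine ⟨z, ?_, hχ.trans ?_⟩
  · rw [hf.isInducing.tendsto_nhds_iff]
    exact hz
  · rw [stateAfter, hstep, map_add, map_add, trend_boldα hperp, add_zero, trend_stackedState,
      trend_elim, Matrix.mulVec_zero, sub_zero, ← Matrix.mulVec_add]

end NLVAR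

/-! ### Strict stability of the attractor space -/

theorem mainTheorem2 {p m q r : ℕ} (hpq : q + r = p) (M : NLVAR p m)
    (α : Matrix (Fin p) (Fin r) ℝ) (b ρ : ℝ) (hM : M.InCVAR α b ρ)
    (μ : Fin r → ℝ) (hμ : M.c = α.mulVec μ)
    (θ : (Fin p → ℝ) → (Fin r → ℝ)) (hθ : ∀ z, M.eqmap z = α.mulVec (θ z))
    (αperp : Matrix (Fin p) (Fin q) ℝ) (hrank : αperp.rank = q)
    (hperp : αperp.transpose * α = 0) :
    IsHomeomorph (M.χ αperp θ) ∧
    attractorSpace μ θ = {z | M.eqmap z = -M.c} ∧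
    Nonempty (attractorSpace μ θ ≃ₜ (Fin q → ℝ)) ∧
    (∀ (u : Fin p → ℝ) (ς : Fin (m + 1) → Fin p → ℝ),
      Tendsto (M.path u ς) atTop (𝓝 (M.zlim αperp μ θ u ς)) ∧
      M.zlim αperp μ θ u ς ∈ attractorSpace μ θ) ∧
    (∀ z ∈ attractorSpace μ θ, ∀ ς : Fin (m + 1) → Fin p → ℝ,
      M.domainOfAttraction z ς = M.shockSpace α z ς ∧
      Module.finrank ℝ (M.shockSpace α z ς).direction = r) ∧
    M.IsStrictlyStable (attractorSpace μ θ) := by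
  have hf : IsHomeomorph (M.f 0) := hM.2.2.2.1
  have hα : α.rank = r := hM.1
  obtain ⟨ℬ, hℬ⟩ := hM.exists_contractingIncrements hθ
  have hχ : IsHomeomorph (M.χ αperp θ) := NLVAR.isHomeomorph_χ hf hℬ hpq hα hrank hperp
  have hlim : ∀ u ς, Tendsto (M.path u ς) atTop (𝓝 (M.zlim αperp μ θ u ς)) ∧
      M.χ αperp θ (M.zlim αperp μ θ u ς) =
        (αperp.transpose.mulVec (M.hbar ς + u), -μ) := fun u ς => by
    obtain ⟨z, hz, hz'⟩ := NLVAR.exists_tendsto_path hf hℬ hperp hμ hθ u ς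
    have : M.zlim αperp μ θ u ς = z := by
      rw [NLVAR.zlim, ← hz']
      exact Function.leftInverse_invFun hχ.injective z
    rw [this]
    exact ⟨hz, hz'⟩
  have hmem : ∀ u ς, M.zlim αperp μ θ u ς ∈ attractorSpace μ θ := fun u ς =>
    congrArg Prod.snd (hlim u ς).2
  have hdom : ∀ z ∈ attractorSpace μ θ, ∀ ς : Fin (m + 1) → Fin p → ℝ,
      M.domainOfAttraction z ς = M.shockSpace α z ς := by
    intro z hz ς
    ext u
    have h1 : u ∈ M.domainOfAttraction z ς ↔ M.zlim αperp μ θ u ς = z :=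
      ⟨fun h => tendsto_nhds_unique (hlim u ς).1 h, fun h => h ▸ (hlim u ς).1⟩
    have hz' : M.χ αperp θ z = (αperp.transpose.mulVec (M.h z), -μ) := Prod.ext rfl hz
    rw [h1, ← hχ.injective.eq_iff, (hlim u ς).2, hz', Prod.mk.injEq, and_iff_left rfl,
      ← sub_eq_zero, ← Matrix.mulVec_sub,
      Matrix.transpose_mulVec_eq_zero_iff hpq hα hrank hperp, NLVAR.shockSpace, SetLike.mem_coe,
      AffineSubspace.mem_mk', vsub_eq_sub, show u - (M.h z - M.hbar ς) = M.hbar ς + u - M.h z by abel]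
  refine ⟨hχ, ?_, ?_, fun u ς => ⟨(hlim u ς).1, hmem u ς⟩, fun z hz ς => ⟨hdom z hz ς, ?_⟩,
    fun u ς => ⟨_, hmem u ς, (hlim u ς).1⟩, fun z hz ς => ?_⟩
  · ext z
    rw [attractorSpace, Set.mem_ofPred_eq, Set.mem_ofPred_eq, hθ, hμ, ← Matrix.mulVec_neg,
      (Matrix.injective_mulVec_of_rank_eq hα).eq_iff]
  · let e := hχ.homeomorph
    refine ⟨⟨⟨fun z => (e z).1, fun y => ⟨e.symm (y, -μ), ?_⟩, fun z => ?_, fun y => ?_⟩, ?_, ?_⟩⟩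
    · exact congrArg Prod.snd (e.apply_symm_apply (y, -μ))
    · refine Subtype.ext ?_
      change e.symm ((e z).1, -μ) = z
      rw [e.symm_apply_eq]
      exact Prod.ext rfl (Eq.symm z.2)
    · change (e (e.symm (y, -μ))).1 = y
      rw [e.apply_symm_apply]
    · exact (continuous_fst.comp e.continuous).comp continuous_subtype_val
    · exact (e.symm.continuous.comp (continuous_id.prodMk continuous_const)).subtype_mk _
  · rw [NLVAR.shockSpace, AffineSubspace.direction_mk']
    exact hα
  · rw [hdom z hz ς]
    exact ⟨_, AffineSubspace.self_mem_mk' _ _⟩
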